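/- Let $\mathcal H,\mathcal K$ be complex Hilbert spaces and let $\Phi:\mathcal B(\mathcal H)\to\mathcal B(\mathcal K)$ be a positive linear map ($X\ge 0$ implies $\Phi(X)\ge 0$) that is unital ($\Phi(I)=I$). Let $m,m',M',M$ be real numbers with $m>0$ and let $A,B\in\mathcal B(\mathcal H)$ be such that $$0<m\le B\le m'<M'\le A\le M\qquad\text{or}\qquad 0<m\le A\le m'<M'\le B\le M,$$ where scalars are identified with multiples of the identity and $\le$ between operators is the order $X\le Y\iff Y-X\ge 0$. For $\nu\in[0,1]$ and strictly positive invertible operators $X,Y$ put $$X\nabla_\nu Y=(1-\nu)X+\nu Y,\qquad X\#_\nu Y=X^{1/2}\bigl(X^{-1/2}YX^{-1/2}\bigr)^{\nu}X^{1/2},$$ and let $K(t)=\frac{(t+1)^2}{4t}$ for $t>0$, $h=\frac Mm$, $h'=\frac{M'}{m'}$, $r=\min\{\nu,1-\nu\}$. Then for all real $p\ge 4$ and all $\nu\in[0,1]$, $$\Phi(A\nabla_\nu B)^p\le\left(\frac{\sqrt{K(h^2)}\,K(h)}{2^{\frac4p-1}K(h')^r}\right)^{p}\Phi(A\#_\nu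 B)^p$$ and $$\Phi(A\nabla_\nu B)^p\le\left(\frac{\sqrt{K(h^2)}\,K(h)}{2^{\frac4p-1}K(h')^r}\right)^{p}\bigl(\Phi(A)\#_\nu\Phi(B)\bigr)^p .$$ -/

import Mathlib

/-- The Kantorovich constant `K(h) = (h + 1)² / (4h)`. -/
noncomputable def kantorovich (h : ℝ) : ℝ := (h + 1) ^ 2 / (4 * h)

/-- The weighted arithmetic mean `A ∇_ν B = (1 - ν) A + ν B`. -/
noncomputable def weightedArithMean {𝓐 : Type*} [CStarAlgebra 𝓐] (ν : ℝ) (A B : 𝓐) : 𝓐 :=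
  (1 - ν) • A + ν • B

/-- The weighted geometric mean `A #_ν B = A^{1/2} (A^{-1/2} B A^{-1/2})^ν A^{1/2}` of strictly
positive elements; the powers are taken in the continuous functional calculus. -/
noncomputable def weightedGeomMean {𝓐 : Type*} [CStarAlgebra 𝓐] [PartialOrder 𝓐]
    [StarOrderedRing 𝓐] (ν : ℝ) (A B : 𝓐) : 𝓐 :=
  A ^ (1 / 2 : ℝ) * (A ^ (-(1 / 2) : ℝ) * B * A ^ (-(1 / 2) : ℝ)) ^ ν * A ^ (1 / 2 : ℝ)

/-! Write `κ = K(h')^r`. As `(M - t)(t - m) ≥ 0` on `[m, M]`, both `A` and `B` satisfy `X + M m X⁻¹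
≤ M + m`, and averaging bounds `A ∇ B + M m (A⁻¹ ∇ B⁻¹)`. The gap between `A` and `B` keeps the
spectrum of `A^{-1/2} B A^{-1/2}` out of `(1/h', h')`, so Young's inequality with the Kantorovich
constant gives `κ (A # B)⁻¹ ≤ A⁻¹ ∇ B⁻¹`. Applying `Φ` and Choi's inequality yields `x + M m κ y⁻¹ ≤
M + m` for `x = Φ(A ∇ B)`, `y = Φ(A # B)`. For `y = Φ(A) # Φ(B)` the same bound holds directly,
because `Φ(A)`, `Φ(B)` inherit the sandwich condition.

An operator form of `‖ab‖ ≤ ‖a + b‖² / 4` (`mul_mul_self_mul_le`) turns this sum into `x² ≤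
(K(h)/κ)² y²`. Inverting and inserting into `x² + M² m² x⁻² ≤ M² + m²` gives a sum estimate for the
squares. A second use of the product bound, on powers of order `p/4 ≥ 1`, reaches order `p`; this is
where `p ≥ 4` enters. -/

section CStar

/-! ### A product bound for positive elements -/

variable {𝓐 : Type*} [CStarAlgebra 𝓐] [PartialOrder 𝓐] [StarOrderedRing 𝓐]

/-- If `0 ≤ a`, `0 ≤ b` and `a + b ≤ 1` then `(a y + b x)⋆ (a y + b x) ≤ y⋆ a y + x⋆ b x`. -/
lemma star_mul_self_le_of_add_le_one {a b : 𝓐} (ha : 0 ≤ a) (hb : 0 ≤ b) (hab : a + b ≤ 1)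
    (x y : 𝓐) :
    star (a * y + b * x) * (a * y + b * x) ≤ star y * a * y + star x * b * x := by
  set z := a * y + b * x with hz
  -- A variance argument: the points `y`, `x`, `0` carry weights `a`, `b`, `1 - (a + b)`, and `z` is
  -- their mean.
  have h1 := star_left_conjugate_nonneg ha (y - z)
  have h2 := star_left_conjugate_nonneg hb (x - z)
  have h3 := star_left_conjugate_nonneg (sub_nonneg.mpr hab) z
  have hsz : star z = star y * a + star x * b := by
    simp [hz, (IsSelfAdjoint.of_nonneg ha).star_eq, (IsSelfAdjoint.of_nonneg hb).star_eq]
  rw [← sub_nonneg]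
  have h := add_nonneg (add_nonneg h1 h2) h3
  have key : star (y - z) * a * (y - z) + star (x - z) * b * (x - z) + star z * (1 - (a + b)) * z
      = star y * a * y + star x * b * x - (star y * a + star x * b) * z
        - star z * (a * y + b * x) + star z * z := by
    simp only [star_sub]; noncomm_ring
  rw [key, ← hsz, ← hz] at h
  simpa using h

lemma sub_mul_self_le_quarter {a : 𝓐} (ha : 0 ≤ a) : a - a * a ≤ (1 / 4 : ℝ) • 1 := by
  have h := (IsSelfAdjoint.of_nonneg ha).sub (IsSelfAdjoint.smul (r := (1 / 2 : ℝ))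
    (IsSelfAdjoint.all _) (IsSelfAdjoint.one 𝓐)) |>.mul_self_nonneg
  rw [← sub_nonneg]
  convert h using 1
  simp only [sub_mul, mul_sub, smul_mul_assoc, mul_smul_comm, one_mul, mul_one]
  module

/-- An operator form of `‖a b‖ ≤ ‖a + b‖² / 4`. -/
lemma mul_mul_self_mul_le {a b : 𝓐} (ha : 0 ≤ a) (hb : 0 ≤ b) (hab : a + b ≤ 1) :
    b * (a * a) * b ≤ (1 / 16 : ℝ) • 1 := by
  have sa := (IsSelfAdjoint.of_nonneg ha).star_eq
  have sb := (IsSelfAdjoint.of_nonneg hb).star_eq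
  set T := a * b with hT
  have hsT : star T = b * a := by simp [hT, sa, sb]
  -- Expanding gives `8 T⋆T ≤ 16 T⋆(a - a²)T + (b - b²)`; the two quarter bounds leave `4 T⋆T ≤
  -- 1/4`. The scale `c = 4` maximizes `2c - c²/4`.
  have h1 := star_mul_self_le_of_add_le_one ha hb hab 1 ((4 : ℝ) • T)
  have h2 := star_left_conjugate_le_conjugate (sub_mul_self_le_quarter ha) ((4 : ℝ) • T)
  have h3 := sub_mul_self_le_quarter hb
  have hTT : b * (a * a) * b = star T * T := by rw [hsT]; simp only [hT, mul_assoc]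
  rw [hTT]
  have h4 := add_nonneg (add_nonneg (sub_nonneg.mpr h1) (sub_nonneg.mpr h2)) (sub_nonneg.mpr h3)
  have h5 : (0 : 𝓐) ≤ (1 / 4 : ℝ) • 1 - (4 : ℝ) • (star T * T) := by
    convert h4 using 1
    simp only [star_add, star_mul, star_smul, sa, sb, star_one, star_trivial, mul_one, one_mul,
      smul_mul_assoc, mul_smul_comm, smul_smul, mul_add, add_mul, mul_sub, sub_mul]
    have e1 : b * (a * T) = star T * T := by rw [hsT, mul_assoc]
    have e2 : star T * a * b = star T * T := by rw [hT, mul_assoc]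
    simp only [← mul_assoc] at e1 e2 ⊢
    simp only [e1, e2]
    module
  have h6 := smul_nonneg (by norm_num : (0 : ℝ) ≤ 1 / 4) h5
  rw [← sub_nonneg]
  convert h6 using 1
  simp only [smul_sub, smul_smul]
  norm_num

/-! ### Spectral bounds and comparison of real powers -/

lemma spectrum_subset_Icc_of_le {a : 𝓐} {m M : ℝ} (ha : IsSelfAdjoint a) (h1 : m • 1 ≤ a)
    (h2 : a ≤ M • 1) : spectrum ℝ a ⊆ Set.Icc m M := fun x hx =>
  ⟨(algebraMap_le_iff_le_spectrum ha).1 (by rwa [Algebra.algebraMap_eq_smul_one]) x hx,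
    (le_algebraMap_iff_spectrum_le ha).1 (by rwa [Algebra.algebraMap_eq_smul_one]) x hx⟩

lemma isStrictlyPositive_of_smul_one_le {a : 𝓐} {m : ℝ} (hm : 0 < m) (h1 : m • 1 ≤ a) :
    IsStrictlyPositive a :=
  (IsStrictlyPositive.smul hm isStrictlyPositive_one).of_le h1

lemma continuousOn_rpow_spectrum {a : 𝓐} (ha : IsStrictlyPositive a) (s : ℝ) :
    ContinuousOn (fun x : ℝ => x ^ s) (spectrum ℝ a) :=
  ContinuousOn.rpow_const continuousOn_id fun _ hx => .inl (ha.spectrum_pos hx).ne'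

lemma rpow_le_self_of_le_one {a : 𝓐} (ha : 0 ≤ a) (ha1 : a ≤ 1) {s : ℝ} (hs : 1 ≤ s) :
    a ^ s ≤ a := by
  have hsp : spectrum ℝ a ⊆ Set.Icc 0 1 :=
    spectrum_subset_Icc_of_le (.of_nonneg ha) (by simpa) (by simpa)
  conv_rhs => rw [← cfc_id ℝ a]
  rw [CFC.rpow_eq_cfc_real]
  refine cfc_mono (fun x hx => ?_)
    (ContinuousOn.rpow_const continuousOn_id fun _ _ => .inr (by linarith))
  simpa using Real.rpow_le_rpow_of_exponent_ge' (hsp hx).1 (hsp hx).2 zero_le_one hs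

lemma smul_rpow {a : 𝓐} (ha : IsStrictlyPositive a) {c : ℝ} (hc : 0 < c) (s : ℝ) :
    (c • a) ^ s = c ^ s • a ^ s := by
  have hca : IsStrictlyPositive (c • a) := ha.smul hc
  have hcont : ContinuousOn (fun x : ℝ => x ^ s) ((c • ·) '' spectrum ℝ a) := by
    refine ContinuousOn.rpow_const continuousOn_id ?_
    rintro _ ⟨x, hx, rfl⟩
    exact .inl (mul_pos hc (ha.spectrum_pos hx)).ne'
  rw [CFC.rpow_eq_cfc_real hca.nonneg, CFC.rpow_eq_cfc_real ha.nonneg,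
    ← cfc_smul _ _ _ (continuousOn_rpow_spectrum ha s),
    ← cfc_comp_smul c _ a hcont ha.isSelfAdjoint]
  refine cfc_congr fun x hx => ?_
  simp [Real.mul_rpow hc.le (ha.spectrum_pos hx).le]

lemma rpow_eq_of_mul_eq_one {a b : 𝓐} (ha : IsStrictlyPositive a) (hab : a * b = 1) :
    a ^ (-1 : ℝ) = b := by
  have h := CFC.rpow_neg_mul_rpow 1 ha
  rw [CFC.rpow_one a ha.nonneg] at h
  exact left_inv_eq_right_inv h hab

/-- From `a x + b y⁻¹ ≤ 1` one gets a comparison of all powers `≥ 2` of `x` and `y`. -/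
lemma rpow_le_smul_rpow_of_add_inv_le_one {x y : 𝓐} (hx : IsStrictlyPositive x)
    (hy : IsStrictlyPositive y) {a b s : ℝ} (ha : 0 < a) (hb : 0 < b) (hs : 1 ≤ s)
    (h : a • x + b • y ^ (-1 : ℝ) ≤ 1) :
    x ^ (2 * s) ≤ (1 / (16 * (a * b) ^ (2 * s))) • y ^ (2 * s) := by
  have hy' : IsStrictlyPositive (y ^ (-1 : ℝ)) := hy.rpow y _
  have hax : IsStrictlyPositive (a • x) := hx.smul ha
  have hby : IsStrictlyPositive (b • y ^ (-1 : ℝ)) := hy'.smul hb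
  have h1 := (le_add_of_nonneg_right hby.nonneg).trans h
  have h2 := (le_add_of_nonneg_left hax.nonneg).trans h
  -- Both summands are positive contractions, so raising each to a power `s ≥ 1` decreases it and
  -- the sum stays below `1`.
  have h3 := (add_le_add (rpow_le_self_of_le_one hax.nonneg h1 hs)
    (rpow_le_self_of_le_one hby.nonneg h2 hs)).trans h
  have h4 := mul_mul_self_mul_le CFC.rpow_nonneg CFC.rpow_nonneg h3
  rw [smul_rpow hx ha, smul_rpow hy' hb, CFC.rpow_rpow y _ _ (by norm_num) hy] at h4
  have has : 0 < a ^ s := Real.rpow_pos_of_pos ha s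
  have hbs : 0 < b ^ s := Real.rpow_pos_of_pos hb s
  have hys : 0 ≤ y ^ s := CFC.rpow_nonneg
  have h5 := conjugate_le_conjugate_of_nonneg h4 hys
  have e1 : x ^ (2 * s) = x ^ s * x ^ s := by rw [two_mul, CFC.rpow_add hx.isUnit]
  have e2 : y ^ (2 * s) = y ^ s * y ^ s := by rw [two_mul, CFC.rpow_add hy.isUnit]
  have e3 : y ^ s * y ^ (-1 * s) = 1 := by rw [neg_one_mul]; exact CFC.rpow_mul_rpow_neg s hy
  have e4 : y ^ (-1 * s) * y ^ s = 1 := by rw [neg_one_mul]; exact CFC.rpow_neg_mul_rpow s hy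
  have e5 : y ^ s * (b ^ s • y ^ (-1 * s) * (a ^ s • x ^ s * a ^ s • x ^ s) *
      b ^ s • y ^ (-1 * s)) * y ^ s = ((a * b) ^ (2 * s)) • x ^ (2 * s) := by
    simp only [smul_mul_assoc, mul_smul_comm, smul_smul]
    congr 1
    · rw [Real.mul_rpow ha.le hb.le, two_mul, Real.rpow_add ha, Real.rpow_add hb]; ring
    · calc _ = (y ^ s * y ^ (-1 * s)) * (x ^ s * x ^ s) * (y ^ (-1 * s) * y ^ s) := by
            simp only [mul_assoc]
        _ = _ := by rw [e3, e4, e1]; simp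
  rw [e5] at h5
  simp only [smul_mul_assoc, mul_smul_comm, mul_one, ← e2] at h5
  have hc : 0 < (a * b) ^ (2 * s) := Real.rpow_pos_of_pos (mul_pos ha hb) _
  have h6 := smul_le_smul_of_nonneg_left h5 (inv_nonneg.2 hc.le)
  rw [smul_smul, inv_mul_cancel₀ hc.ne', one_smul, smul_smul] at h6
  convert h6 using 2
  field_simp

lemma add_smul_inv_le {x : 𝓐} {m M : ℝ} (hm : 0 < m) (h1 : m • 1 ≤ x) (h2 : x ≤ M • 1) :
    x + (M * m) • x ^ (-1 : ℝ) ≤ (M + m) • 1 := by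
  have hx := isStrictlyPositive_of_smul_one_le hm h1
  have hsp := spectrum_subset_Icc_of_le hx.isSelfAdjoint h1 h2
  have hc := continuousOn_rpow_spectrum hx (-1)
  have hc' : ContinuousOn (fun t : ℝ => (M * m) • t ^ (-1 : ℝ)) (spectrum ℝ x) :=
    hc.const_smul (M * m)
  have : x + (M * m) • x ^ (-1 : ℝ) = cfc (fun t : ℝ => t + (M * m) • t ^ (-1 : ℝ)) x := by
    rw [cfc_add (a := x) (fun t : ℝ => t) (fun t => (M * m) • t ^ (-1 : ℝ)) continuousOn_id
      hc', cfc_smul _ _ _ hc, cfc_id' ℝ x, CFC.rpow_eq_cfc_real hx.nonneg]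
  rw [this, ← Algebra.algebraMap_eq_smul_one]
  refine cfc_le_algebraMap _ _ _ (fun t ht => ?_) (continuousOn_id.add hc')
  obtain ⟨ht1, ht2⟩ := hsp ht
  have ht0 : 0 < t := hm.trans_le ht1
  rw [Real.rpow_neg_one, smul_eq_mul, ← sub_nonneg]
  have : M + m - (t + M * m * t⁻¹) = (M - t) * (t - m) / t := by field_simp; ring
  rw [this]
  exact div_nonneg (mul_nonneg (by linarith) (by linarith)) ht0.le

lemma sq_bounds {x : 𝓐} {m M : ℝ} (hm : 0 < m) (h1 : m • 1 ≤ x) (h2 : x ≤ M • 1) :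
    (m ^ 2) • 1 ≤ x ^ (2 : ℝ) ∧ x ^ (2 : ℝ) ≤ (M ^ 2) • 1 := by
  have hx := isStrictlyPositive_of_smul_one_le hm h1
  have hsp := spectrum_subset_Icc_of_le hx.isSelfAdjoint h1 h2
  have hc := continuousOn_rpow_spectrum hx 2
  rw [← Algebra.algebraMap_eq_smul_one, ← Algebra.algebraMap_eq_smul_one,
    CFC.rpow_eq_cfc_real hx.nonneg]
  refine ⟨algebraMap_le_cfc _ _ _ (fun t ht => ?_) hc, cfc_le_algebraMap _ _ _ (fun t ht => ?_) hc⟩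
  · have := hsp ht
    simpa using pow_le_pow_left₀ hm.le this.1 2
  · have := hsp ht
    simpa using pow_le_pow_left₀ (hm.le.trans this.1) this.2 2

end CStar

/-! ### Scalar inequalities for the Kantorovich constant -/

section Scalar

lemma kantorovich_pos {t : ℝ} (ht : 0 < t) : 0 < kantorovich t := by
  unfold kantorovich; positivity

/-- Follows from `K(t) - K(h) = (t - h)(th - 1) / (4th)`. -/
lemma kantorovich_le_of_inv_le_or_le {h t : ℝ} (hh : 1 ≤ h) (ht : 0 < t)
    (hht : t ≤ h⁻¹ ∨ h ≤ t) : kantorovich h ≤ kantorovich t := by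
  have h0 : 0 < h := by linarith
  have key : 0 ≤ (t - h) * (t * h - 1) := by
    rcases hht with H | H
    · have h1 : t * h ≤ 1 := by
        calc t * h ≤ h⁻¹ * h := mul_le_mul_of_nonneg_right H h0.le
          _ = 1 := inv_mul_cancel₀ h0.ne'
      have h2 : t ≤ h := H.trans ((inv_le_one_of_one_le₀ hh).trans hh)
      exact mul_nonneg_of_nonpos_of_nonpos (by linarith) (by linarith)
    · exact mul_nonneg (by linarith) (by nlinarith)
  unfold kantorovich
  rw [div_le_div_iff₀ (by positivity) (by positivity)]
  nlinarith

lemma kantorovich_mul_self {t : ℝ} (ht : 0 < t) : kantorovich t * t = ((1 + t) / 2) ^ (2 : ℝ) := by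
  rw [Real.rpow_two, kantorovich]; field_simp; ring

/-- The Young inequality with the Kantorovich constant. -/
lemma kantorovich_rpow_mul_rpow_le {t ν : ℝ} (ht : 0 < t) (hν : ν ∈ Set.Icc (0 : ℝ) 1) :
    kantorovich t ^ min ν (1 - ν) * t ^ ν ≤ (1 - ν) + ν * t := by
  obtain ⟨h0, h1⟩ := hν
  have hk := kantorovich_pos ht
  have hs : 0 < (1 + t) / 2 := by positivity
  rcases le_total ν (1 - ν) with H | H
  · rw [min_eq_left H, ← Real.mul_rpow hk.le ht.le, kantorovich_mul_self ht, ← Real.rpow_mul hs.le]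
    -- Weighted AM-GM between the midpoint `(1 + t)/2` and the endpoint `1`; for `ν ≥ 1/2` the
    -- endpoint is `t`.
    have := Real.geom_mean_le_arith_mean2_weighted (w₁ := 2 * ν) (w₂ := 1 - 2 * ν)
      (by linarith) (by linarith) hs.le zero_le_one (by ring)
    rw [Real.one_rpow, mul_one] at this
    linarith
  · rw [min_eq_right H]
    have e : t ^ ν = t ^ (1 - ν) * t ^ (2 * ν - 1) := by rw [← Real.rpow_add ht]; ring_nf
    rw [e, ← mul_assoc, ← Real.mul_rpow hk.le ht.le, kantorovich_mul_self ht,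
      ← Real.rpow_mul hs.le]
    have := Real.geom_mean_le_arith_mean2_weighted (w₁ := 2 * (1 - ν)) (w₂ := 2 * ν - 1)
      (by linarith) (by linarith) hs.le ht.le (by ring)
    linarith

end Scalar

/-! ### Inverses of weighted geometric means -/

section GeomMean

variable {𝓐 : Type*} [CStarAlgebra 𝓐] [PartialOrder 𝓐] [StarOrderedRing 𝓐]

lemma IsStrictlyPositive.conjugate_rpow {a b : 𝓐} (ha : IsStrictlyPositive a)
    (hb : IsStrictlyPositive b) (s : ℝ) : IsStrictlyPositive (a ^ s * b * a ^ s) := by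
  have h := ha.rpow a s
  exact hb.conjugate_of_isUnit_of_isSelfAdjoint _ _ h.isUnit h.isSelfAdjoint

lemma isStrictlyPositive_weightedGeomMean {a b : 𝓐} (ha : IsStrictlyPositive a)
    (hb : IsStrictlyPositive b) (ν : ℝ) : IsStrictlyPositive (weightedGeomMean ν a b) :=
  ha.conjugate_rpow ((ha.conjugate_rpow hb _).rpow _ _) _

lemma rpow_mul_rpow_cancel {a : 𝓐} (ha : IsStrictlyPositive a) {s t : ℝ} (hst : s + t = 0) :
    a ^ s * a ^ t = 1 := by
  rw [← CFC.rpow_add ha.isUnit, hst, CFC.rpow_zero a ha.nonneg]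

lemma conjugate_rpow_inv {a b : 𝓐} (ha : IsStrictlyPositive a) (hb : IsStrictlyPositive b)
    {s t : ℝ} (hst : s + t = 0) :
    (a ^ s * b * a ^ s) ^ (-1 : ℝ) = a ^ t * b ^ (-1 : ℝ) * a ^ t := by
  refine rpow_eq_of_mul_eq_one (ha.conjugate_rpow hb s) ?_
  have hb1 : b * b ^ (-1 : ℝ) = 1 := by
    simpa [CFC.rpow_one b hb.nonneg] using CFC.rpow_mul_rpow_neg 1 hb
  calc _ = a ^ s * b * (a ^ s * a ^ t) * b ^ (-1 : ℝ) * a ^ t := by simp only [mul_assoc]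
    _ = a ^ s * (b * b ^ (-1 : ℝ)) * a ^ t := by
      rw [rpow_mul_rpow_cancel ha hst]; simp only [mul_assoc, one_mul]
    _ = 1 := by rw [hb1, mul_one, rpow_mul_rpow_cancel ha hst]

/-- The refined arithmetic-geometric mean inequality applied to inverses. -/
lemma kantorovich_smul_weightedGeomMean_inv_le {a b : 𝓐} (ha : IsStrictlyPositive a)
    (hb : IsStrictlyPositive b) {h ν : ℝ} (hh : 1 ≤ h) (hν : ν ∈ Set.Icc (0 : ℝ) 1)
    (hab : b ≤ h⁻¹ • a ∨ h • a ≤ b) :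
    (kantorovich h ^ min ν (1 - ν)) • (weightedGeomMean ν a b) ^ (-1 : ℝ) ≤
      (1 - ν) • a ^ (-1 : ℝ) + ν • b ^ (-1 : ℝ) := by
  set T := a ^ (-(1 / 2) : ℝ) * b * a ^ (-(1 / 2) : ℝ) with hT
  have hTp : IsStrictlyPositive T := ha.conjugate_rpow hb _
  set κ := kantorovich h ^ min ν (1 - ν) with hκ
  have h0 : 0 < h := by linarith
  have hcν := continuousOn_rpow_spectrum hTp (-ν)
  have hc1 := continuousOn_rpow_spectrum hTp (-1)
  have haa : a ^ (-(1 / 2) : ℝ) * a * a ^ (-(1 / 2) : ℝ) = 1 := CFC.conjugate_rpow_neg_one_half a ha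
  have hp : 0 ≤ a ^ (-(1 / 2) : ℝ) := CFC.rpow_nonneg
  have hspec : ∀ t ∈ spectrum ℝ T, t ≤ h⁻¹ ∨ h ≤ t := by
    intro t ht
    rcases hab with H | H
    · have := conjugate_le_conjugate_of_nonneg H hp
      rw [mul_smul_comm, smul_mul_assoc, haa, ← Algebra.algebraMap_eq_smul_one] at this
      exact .inl ((le_algebraMap_iff_spectrum_le hTp.isSelfAdjoint).1 this t ht)
    · have := conjugate_le_conjugate_of_nonneg H hp
      rw [mul_smul_comm, smul_mul_assoc, haa, ← Algebra.algebraMap_eq_smul_one] at this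
      exact .inr ((algebraMap_le_iff_le_spectrum hTp.isSelfAdjoint).1 this t ht)
  have key : κ • T ^ (-ν) ≤ (1 - ν) • (1 : 𝓐) + ν • T ^ (-1 : ℝ) := by
    have hcν' : ContinuousOn (fun t : ℝ => κ • t ^ (-ν)) (spectrum ℝ T) := hcν.const_smul κ
    have hc1' : ContinuousOn (fun t : ℝ => ν • t ^ (-1 : ℝ)) (spectrum ℝ T) := hc1.const_smul ν
    rw [CFC.rpow_eq_cfc_real hTp.nonneg, CFC.rpow_eq_cfc_real hTp.nonneg, ← cfc_smul _ _ _ hcν,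
      ← cfc_smul _ _ _ hc1, ← Algebra.algebraMap_eq_smul_one,
      ← cfc_const_add _ _ _ hc1' hTp.isSelfAdjoint]
    refine cfc_mono (fun t ht => ?_) hcν' (continuousOn_const.add hc1')
    have ht0 : 0 < t := hTp.spectrum_pos ht
    -- The scalar inequality is used at `t⁻¹`; the excluded interval `(h⁻¹, h)` is invariant under
    -- inversion.
    have h1 := kantorovich_rpow_mul_rpow_le (inv_pos.2 ht0) hν
    have h2 : kantorovich h ≤ kantorovich t⁻¹ := by
      refine kantorovich_le_of_inv_le_or_le hh (inv_pos.2 ht0) ?_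
      rcases hspec t ht with H | H
      · exact .inr ((le_inv_comm₀ ht0 h0).1 H)
      · exact .inl (inv_anti₀ h0 H)
    have h3 : κ ≤ kantorovich t⁻¹ ^ min ν (1 - ν) :=
      Real.rpow_le_rpow (kantorovich_pos h0).le h2 (le_min hν.1 (by linarith [hν.2]))
    rw [smul_eq_mul, smul_eq_mul, Real.rpow_neg_one, Real.rpow_neg ht0.le, ← Real.inv_rpow ht0.le]
    exact (mul_le_mul_of_nonneg_right h3 (Real.rpow_nonneg (inv_pos.2 ht0).le _)).trans h1
  have hG : (weightedGeomMean ν a b) ^ (-1 : ℝ) =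
      a ^ (-(1 / 2) : ℝ) * T ^ (-ν) * a ^ (-(1 / 2) : ℝ) := by
    refine rpow_eq_of_mul_eq_one (isStrictlyPositive_weightedGeomMean ha hb ν) ?_
    have e0 : a ^ (1 / 2 : ℝ) * a ^ (-(1 / 2) : ℝ) = 1 := rpow_mul_rpow_cancel ha (by norm_num)
    have e1 : T ^ ν * T ^ (-ν) = 1 := rpow_mul_rpow_cancel hTp (by ring)
    calc _ = a ^ (1 / 2 : ℝ) * T ^ ν * (a ^ (1 / 2 : ℝ) * a ^ (-(1 / 2) : ℝ)) * T ^ (-ν) *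
          a ^ (-(1 / 2) : ℝ) := by simp only [weightedGeomMean, mul_assoc, hT]
      _ = a ^ (1 / 2 : ℝ) * (T ^ ν * T ^ (-ν)) * a ^ (-(1 / 2) : ℝ) := by
        rw [e0]; simp only [mul_assoc, one_mul]
      _ = 1 := by rw [e1, mul_one, e0]
  have hTi : T ^ (-1 : ℝ) = a ^ (1 / 2 : ℝ) * b ^ (-1 : ℝ) * a ^ (1 / 2 : ℝ) :=
    conjugate_rpow_inv ha hb (by norm_num)
  have e2 : a ^ (-(1 / 2) : ℝ) * a ^ (-(1 / 2) : ℝ) = a ^ (-1 : ℝ) := by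
    rw [← CFC.rpow_add ha.isUnit]; norm_num
  have e3 : a ^ (-(1 / 2) : ℝ) * T ^ (-1 : ℝ) * a ^ (-(1 / 2) : ℝ) = b ^ (-1 : ℝ) := by
    rw [hTi]
    calc _ = (a ^ (-(1 / 2) : ℝ) * a ^ (1 / 2 : ℝ)) * b ^ (-1 : ℝ) *
          (a ^ (1 / 2 : ℝ) * a ^ (-(1 / 2) : ℝ)) := by simp only [mul_assoc]
      _ = _ := by
        rw [rpow_mul_rpow_cancel ha (by norm_num), rpow_mul_rpow_cancel ha (by norm_num)]; simp
  have h4 := conjugate_le_conjugate_of_nonneg key hp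
  simpa only [mul_smul_comm, smul_mul_assoc, mul_add, add_mul, mul_one, ← hG, e2, e3] using h4

end GeomMean

/-! ### Choi's inequality via Bernstein approximation -/

section Choi

open Filter Topology
open scoped unitInterval

/-- A positive unital map on `C([0,1])` satisfies `Ψ(f⁻¹) ≥ 2 z - z Ψ(f) z`. -/
lemma two_smul_le_of_positive_unitInterval {𝓑 : Type*} [CStarAlgebra 𝓑] [PartialOrder 𝓑]
    [StarOrderedRing 𝓑] (Ψ : C(I, ℝ) →L[ℝ] 𝓑) (hpos : ∀ f, 0 ≤ f → 0 ≤ Ψ f) (h1 : Ψ 1 = 1)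
    {f g : C(I, ℝ)} (hf : ∀ x, 0 < f x) (hfg : ∀ x, f x * g x = 1) {z : 𝓑}
    (hz : IsSelfAdjoint z) : 0 ≤ Ψ g - (2 : ℝ) • z + z * Ψ f * z := by
  -- Bernstein polynomials reduce `Ψ` to finitely many positive elements `Ψ(bₖ)` with sum `1`, so
  -- positivity without complete positivity suffices.
  have hB (n : ℕ) (u : C(I, ℝ)) : Ψ (bernsteinApproximation n u) =
      ∑ k : Fin (n + 1), u (bernstein.z k) • Ψ (bernstein n k) := by
    rw [bernsteinApproximation, map_sum]
    refine Finset.sum_congr rfl fun k _ => ?_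
    rw [← map_smul]
    congr 1
    ext x
    simp [mul_comm]
  have hB1 (n : ℕ) : ∑ k : Fin (n + 1), Ψ (bernstein n k) = 1 := by
    rw [← map_sum, ← h1]
    congr 1
    ext x
    simp
  have hlim (u : C(I, ℝ)) : Tendsto (fun n => Ψ (bernsteinApproximation n u)) atTop (𝓝 (Ψ u)) :=
    (Ψ.continuous.tendsto u).comp (bernsteinApproximation_uniform u)
  have ht : Tendsto (fun n => Ψ (bernsteinApproximation n g) - (2 : ℝ) • z +
      z * Ψ (bernsteinApproximation n f) * z) atTop (𝓝 (Ψ g - (2 : ℝ) • z + z * Ψ f * z)) :=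
    ((hlim g).sub tendsto_const_nhds).add (((hlim f).const_mul z).mul_const z)
  refine ge_of_tendsto' ht fun n => ?_
  -- Completing the square at each node, using `f g = 1` there.
  have hsum : Ψ (bernsteinApproximation n g) - (2 : ℝ) • z +
      z * Ψ (bernsteinApproximation n f) * z = ∑ k : Fin (n + 1), g (bernstein.z k) •
        ((1 - f (bernstein.z k) • z) * Ψ (bernstein n k) * (1 - f (bernstein.z k) • z)) := by
    have e : (2 : ℝ) • z = ∑ k : Fin (n + 1), (z * Ψ (bernstein n k) + Ψ (bernstein n k) * z) := by
      rw [Finset.sum_add_distrib, ← Finset.mul_sum, ← Finset.sum_mul, hB1]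
      simp [two_smul]
    rw [hB, hB, e, Finset.mul_sum, Finset.sum_mul, ← Finset.sum_sub_distrib,
      ← Finset.sum_add_distrib]
    refine Finset.sum_congr rfl fun k _ => ?_
    have hk := hfg (bernstein.z k)
    set c := f (bernstein.z k)
    set d := g (bernstein.z k)
    have hk' : d * c = 1 := by rw [mul_comm]; exact hk
    simp only [sub_mul, mul_sub, one_mul, mul_one, smul_mul_assoc, mul_smul_comm, smul_sub,
      smul_smul]
    simp only [← mul_assoc d c c, hk', one_mul, one_smul]
    abel
  rw [hsum]
  refine Finset.sum_nonneg fun k _ => smul_nonneg ?_ ?_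
  · have := hfg (bernstein.z k)
    exact (pos_of_mul_pos_right (by rw [this]; exact one_pos) (hf _).le).le
  · refine IsSelfAdjoint.conjugate_nonneg (hpos _ fun x => bernstein_nonneg) ?_
    exact (IsSelfAdjoint.one _).sub ((IsSelfAdjoint.all _).smul hz)

section RealScalar

variable {𝓐 𝓑 : Type*} [CStarAlgebra 𝓐] [PartialOrder 𝓐] [CStarAlgebra 𝓑] [PartialOrder 𝓑]

lemma PositiveLinearMap.map_real_smul (Φ : 𝓐 →ₚ[ℂ] 𝓑) (c : ℝ) (a : 𝓐) : Φ (c • a) = c • Φ a := by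
  rw [← Complex.coe_smul, ← Complex.coe_smul, map_smul]

lemma PositiveLinearMap.map_smul_one_le (Φ : 𝓐 →ₚ[ℂ] 𝓑) (hΦ : Φ 1 = 1) {a : 𝓐} {m : ℝ}
    (h : m • 1 ≤ a) : m • 1 ≤ Φ a := by
  rw [← hΦ, ← Φ.map_real_smul]
  exact OrderHomClass.mono Φ h

lemma PositiveLinearMap.map_le_smul_one (Φ : 𝓐 →ₚ[ℂ] 𝓑) (hΦ : Φ 1 = 1) {a : 𝓐} {M : ℝ}
    (h : a ≤ M • 1) : Φ a ≤ M • 1 := by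
  rw [← hΦ, ← Φ.map_real_smul]
  exact OrderHomClass.mono Φ h

end RealScalar

variable {𝓐 𝓑 : Type*} [CStarAlgebra 𝓐] [PartialOrder 𝓐] [StarOrderedRing 𝓐]
  [CStarAlgebra 𝓑] [PartialOrder 𝓑] [StarOrderedRing 𝓑]

lemma IsStrictlyPositive.exists_smul_one_le {a : 𝓐} (ha : IsStrictlyPositive a) :
    ∃ m : ℝ, 0 < m ∧ m • 1 ≤ a := by
  rcases subsingleton_or_nontrivial 𝓐 with _ | _
  · exact ⟨1, one_pos, (Subsingleton.elim _ _).le⟩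
  obtain ⟨m, hm, h⟩ := (CFC.exists_pos_algebraMap_le_iff ha.isSelfAdjoint).2
    fun _ hx => ha.spectrum_pos hx
  exact ⟨m, hm, by rwa [Algebra.algebraMap_eq_smul_one] at h⟩

lemma IsStrictlyPositive.map_of_unital (Φ : 𝓐 →ₚ[ℂ] 𝓑) (hΦ : Φ 1 = 1) {a : 𝓐}
    (ha : IsStrictlyPositive a) : IsStrictlyPositive (Φ a) := by
  obtain ⟨m, hm, h⟩ := ha.exists_smul_one_le
  exact isStrictlyPositive_of_smul_one_le hm (Φ.map_smul_one_le hΦ h)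

/-- **Choi's inequality** for the inverse: `Φ(a)⁻¹ ≤ Φ(a⁻¹)` for a positive unital map. -/
lemma rpow_neg_one_map_le_map_rpow_neg_one (Φ : 𝓐 →ₚ[ℂ] 𝓑) (hΦ : Φ 1 = 1) {a : 𝓐}
    (ha : IsStrictlyPositive a) :
    (Φ a) ^ (-1 : ℝ) ≤ Φ (a ^ (-1 : ℝ)) := by
  have hΦa := ha.map_of_unital Φ hΦ
  obtain ⟨m, hm, h1⟩ := ha.exists_smul_one_le
  -- The strict inequality `m < M` allows rescaling the spectrum into `[0, 1]` even for scalar `a`.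
  obtain ⟨M, hmM, h2⟩ : ∃ M : ℝ, m < M ∧ a ≤ M • 1 := by
    refine ⟨max (m + 1) ‖a‖, by simp, ?_⟩
    refine (ha.isSelfAdjoint.le_algebraMap_norm_self).trans ?_
    rw [Algebra.algebraMap_eq_smul_one]
    exact smul_le_smul_of_nonneg_right (le_max_right _ _) zero_le_one
  have hsp := spectrum_subset_Icc_of_le ha.isSelfAdjoint h1 h2
  have hd : 0 < M - m := by linarith
  let u : C(spectrum ℝ a, I) := ⟨fun t => ⟨(t - m) / (M - m),
    div_nonneg (by linarith [(hsp t.2).1]) hd.le, (div_le_one hd).2 (by linarith [(hsp t.2).2])⟩,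
    by fun_prop⟩
  have hfpos (x : I) : 0 < m + (M - m) * (x : ℝ) :=
    add_pos_of_pos_of_nonneg hm (mul_nonneg hd.le x.2.1)
  let f : C(I, ℝ) := ⟨fun x => m + (M - m) * x, by fun_prop⟩
  let g : C(I, ℝ) := ⟨fun x => (m + (M - m) * x)⁻¹,
    Continuous.inv₀ (by fun_prop) fun x => (hfpos x).ne'⟩
  let Φc : 𝓐 →L[ℝ] 𝓑 := ⟨(⟨⟨Φ, map_add Φ⟩, Φ.map_real_smul⟩ : 𝓐 →ₗ[ℝ] 𝓑), map_continuous Φ⟩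
  let Ψ : C(I, ℝ) →L[ℝ] 𝓑 := Φc.comp
    ⟨((cfcHom ha.isSelfAdjoint (R := ℝ)).toAlgHom.toLinearMap ∘ₗ
        (ContinuousMap.compRightAlgHom ℝ ℝ u).toLinearMap),
      (cfcHom_continuous ha.isSelfAdjoint).comp u.continuous_precomp⟩
  have hΨ (v : C(I, ℝ)) : Ψ v = Φ (cfcHom ha.isSelfAdjoint (v.comp u)) := rfl
  have hpos : ∀ v, 0 ≤ v → 0 ≤ Ψ v := fun v hv => by
    rw [hΨ]
    exact map_nonneg Φ ((cfcHom_nonneg_iff ha.isSelfAdjoint).2 fun t => hv _)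
  have hone : Ψ 1 = 1 := by
    rw [hΨ, ContinuousMap.one_comp, map_one, hΦ]
  have hfa : Ψ f = Φ a := by
    rw [hΨ]
    congr 1
    conv_rhs => rw [← cfcHom_id ha.isSelfAdjoint (R := ℝ)]
    congr 1
    ext t
    change m + (M - m) * (((t : ℝ) - m) / (M - m)) = t
    field_simp; ring
  have hga : Ψ g = Φ (a ^ (-1 : ℝ)) := by
    rw [hΨ, CFC.rpow_eq_cfc_real ha.nonneg,
      cfc_apply _ _ ha.isSelfAdjoint (continuousOn_rpow_spectrum ha (-1))]
    congr 2
    ext t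
    change (m + (M - m) * (((t : ℝ) - m) / (M - m)))⁻¹ = (t : ℝ) ^ (-1 : ℝ)
    rw [Real.rpow_neg_one]
    congr 1
    field_simp; ring
  -- With `z = Φ(a)⁻¹`, the expression `2z - z Φ(a) z` collapses to `Φ(a)⁻¹`.
  have h := two_smul_le_of_positive_unitInterval Ψ hpos hone (f := f) (g := g) hfpos
    (fun x => mul_inv_cancel₀ (hfpos x).ne') (z := (Φ a) ^ (-1 : ℝ))
    (IsSelfAdjoint.of_nonneg CFC.rpow_nonneg)
  have e : (Φ a) ^ (-1 : ℝ) * Φ a = 1 := by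
    simpa [CFC.rpow_one _ hΦa.nonneg] using CFC.rpow_neg_mul_rpow 1 hΦa
  rw [hfa, hga, e, one_mul, two_smul] at h
  rw [← sub_nonneg]
  convert h using 1
  abel

end Choi

/-! ### From a sum estimate to powers of order `p` -/

section Main

/-- The passage from a sum estimate to the comparison of powers of order `p ≥ 4`. -/
lemma rpow_le_kantorovich_smul_rpow {𝓐 : Type*} [CStarAlgebra 𝓐] [PartialOrder 𝓐]
    [StarOrderedRing 𝓐] {x y : 𝓐} {m M κ p : ℝ} (hm : 0 < m) (hM : 0 < M) (hκ : 0 < κ)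
    (hp : 4 ≤ p) (h1 : m • 1 ≤ x) (h2 : x ≤ M • 1) (hy : IsStrictlyPositive y)
    (h : x + (M * m * κ) • y ^ (-1 : ℝ) ≤ (M + m) • 1) :
    x ^ p ≤ ((√(kantorovich ((M / m) ^ 2)) * kantorovich (M / m) /
      ((2 : ℝ) ^ (4 / p - 1) * κ)) ^ p) • y ^ p := by
  have hx := isStrictlyPositive_of_smul_one_le hm h1
  have hx2 := hx.rpow x 2
  have hy2 := hy.rpow y 2
  have normalize {u v : 𝓐} {c d : ℝ} (hc : 0 < c) (H : u + d • v ≤ c • 1) :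
      c⁻¹ • u + (c⁻¹ * d) • v ≤ 1 := by
    have := smul_le_smul_of_nonneg_left H (inv_pos.2 hc).le
    rwa [smul_add, smul_smul, smul_smul, inv_mul_cancel₀ hc.ne', one_smul] at this
  have hs : 0 < M + m := by positivity
  have hsq := rpow_le_smul_rpow_of_add_inv_le_one hx hy (inv_pos.2 hs)
    (b := (M + m)⁻¹ * (M * m * κ)) (by positivity) le_rfl (normalize hs h)
  rw [mul_one] at hsq
  set L := (M + m) ^ 2 / (4 * (M * m * κ)) with hL
  have hL0 : 0 < L := by positivity
  have hLe : 1 / (16 * ((M + m)⁻¹ * ((M + m)⁻¹ * (M * m * κ))) ^ (2 : ℝ)) = L ^ 2 := by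
    rw [Real.rpow_two, hL]; field_simp; norm_num
  rw [hLe] at hsq
  -- Inversion reverses `x² ≤ L² y²`, so `L⁻² y⁻² ≤ x⁻²` can replace `x⁻²` in the estimate for
  -- squares.
  have hinv := CStarAlgebra.rpow_neg_one_le_rpow_neg_one hsq hx2
  rw [smul_rpow hy2 (by positivity), Real.rpow_neg_one] at hinv
  obtain ⟨h3, h4⟩ := sq_bounds hm h1 h2
  have h5 := add_smul_inv_le (by positivity : 0 < m ^ 2) h3 h4
  have h6 : x ^ (2 : ℝ) + (M ^ 2 * m ^ 2 * (L ^ 2)⁻¹) • (y ^ (2 : ℝ)) ^ (-1 : ℝ) ≤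
      (M ^ 2 + m ^ 2) • 1 := by
    refine le_trans ?_ h5
    rw [mul_smul]
    exact add_le_add_right (smul_le_smul_of_nonneg_left hinv (by positivity)) _
  have hs2 : 0 < M ^ 2 + m ^ 2 := by positivity
  have h7 := rpow_le_smul_rpow_of_add_inv_le_one hx2 hy2 (inv_pos.2 hs2)
    (b := (M ^ 2 + m ^ 2)⁻¹ * (M ^ 2 * m ^ 2 * (L ^ 2)⁻¹)) (s := p / 4) (by positivity)
    (by linarith) (normalize hs2 h6)
  rw [CFC.rpow_rpow x _ _ two_ne_zero hx, CFC.rpow_rpow y _ _ two_ne_zero hy] at h7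
  have ep : 2 * (2 * (p / 4)) = p := by ring
  rw [ep] at h7
  convert h7 using 2
  have hsqrt : √(kantorovich ((M / m) ^ 2)) = (M ^ 2 + m ^ 2) / (2 * (M * m)) := by
    rw [show kantorovich ((M / m) ^ 2) = ((M ^ 2 + m ^ 2) / (2 * (M * m))) ^ 2 by
      rw [kantorovich]; field_simp; ring]
    exact Real.sqrt_sq (by positivity)
  -- The product of the two weights is `Q⁻²`, so the constant is `Q^p / 16`; the exponent `4/p`
  -- comes from `16 = (2^(4/p))^p`.
  set Q := (M ^ 2 + m ^ 2) * L / (M * m) with hQ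
  have hQ0 : 0 < Q := by positivity
  have hC : √(kantorovich ((M / m) ^ 2)) * kantorovich (M / m) / ((2 : ℝ) ^ (4 / p - 1) * κ) =
      Q / 2 ^ (4 / p) := by
    rw [hsqrt, hQ, hL, kantorovich, Real.rpow_sub two_pos, Real.rpow_one]
    have : (2 : ℝ) ^ (4 / p) ≠ 0 := (Real.rpow_pos_of_pos two_pos _).ne'
    field_simp
  have h2p : ((2 : ℝ) ^ (4 / p)) ^ p = 16 := by
    rw [← Real.rpow_mul two_pos.le, div_mul_cancel₀ _ (by linarith)]; norm_num
  have hab : (M ^ 2 + m ^ 2)⁻¹ * ((M ^ 2 + m ^ 2)⁻¹ * (M ^ 2 * m ^ 2 * (L ^ 2)⁻¹)) =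
      (Q⁻¹) ^ (2 : ℝ) := by
    rw [Real.rpow_two, hQ]; field_simp
  rw [hC, Real.div_rpow hQ0.le (Real.rpow_nonneg two_pos.le _), h2p, hab,
    ← Real.rpow_mul (inv_pos.2 hQ0).le, ep, Real.inv_rpow hQ0.le]
  have := (Real.rpow_pos_of_pos hQ0 p).ne'
  field_simp

/-! ### The sum estimate for sandwiched pairs -/

section GeomMean

variable {𝓐 : Type*} [CStarAlgebra 𝓐] [PartialOrder 𝓐] [StarOrderedRing 𝓐]

/-- The sandwich condition on a pair of elements. -/
def IsSandwiched (m m' M' M : ℝ) (a b : 𝓐) : Prop :=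
  (m • 1 ≤ b ∧ b ≤ m' • 1 ∧ M' • 1 ≤ a ∧ a ≤ M • 1) ∨
    (m • 1 ≤ a ∧ a ≤ m' • 1 ∧ M' • 1 ≤ b ∧ b ≤ M • 1)

variable {m m' M' M : ℝ} {a b : 𝓐}

lemma IsSandwiched.bounds (h : IsSandwiched m m' M' M a b) (hmm : m ≤ m') (hm' : m' < M')
    (hMM : M' ≤ M) : m • 1 ≤ a ∧ a ≤ M • 1 ∧ m • 1 ≤ b ∧ b ≤ M • 1 := by
  have mono {c d : ℝ} (hcd : c ≤ d) : c • (1 : 𝓐) ≤ d • 1 :=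
    smul_le_smul_of_nonneg_right hcd zero_le_one
  rcases h with ⟨h1, h2, h3, h4⟩ | ⟨h1, h2, h3, h4⟩
  · exact ⟨(mono (hmm.trans hm'.le)).trans h3, h4, h1, h2.trans (mono (hm'.le.trans hMM))⟩
  · exact ⟨h1, h2.trans (mono (hm'.le.trans hMM)), (mono (hmm.trans hm'.le)).trans h3, h4⟩

/-- Serves to recover `m ≤ m'` and `M' ≤ M` from the operator inequalities. -/
lemma le_of_smul_one_le_smul_one [Nontrivial 𝓐] {c d : ℝ} (h : c • (1 : 𝓐) ≤ d • 1) : c ≤ d := by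
  rw [← Algebra.algebraMap_eq_smul_one, ← Algebra.algebraMap_eq_smul_one] at h
  have hs := (le_algebraMap_iff_spectrum_le (R := ℝ) (IsSelfAdjoint.algebraMap 𝓐 (.all c))).1 h
  exact hs c (by rw [spectrum.scalar_eq]; rfl)

lemma IsSandwiched.weightedArithMean_add_le (h : IsSandwiched m m' M' M a b) (hm : 0 < m)
    (hmm : m ≤ m') (hm' : m' < M') (hMM : M' ≤ M) {ν : ℝ} (hν : ν ∈ Set.Icc (0 : ℝ) 1) :
    weightedArithMean ν a b + (M * m * kantorovich (M' / m') ^ min ν (1 - ν)) •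
      (weightedGeomMean ν a b) ^ (-1 : ℝ) ≤ (M + m) • 1 := by
  obtain ⟨ha1, ha2, hb1, hb2⟩ := h.bounds hmm hm' hMM
  have ha := isStrictlyPositive_of_smul_one_le hm ha1
  have hb := isStrictlyPositive_of_smul_one_le hm hb1
  have hm0 : 0 < m' := hm.trans_le hmm
  have hM0 : 0 < M' := hm0.trans hm'
  have hM : 0 < M := hM0.trans_le hMM
  have hh : 1 ≤ M' / m' := (one_le_div hm0).2 hm'.le
  have hab : b ≤ (M' / m')⁻¹ • a ∨ (M' / m') • a ≤ b := by
    rcases h with ⟨-, h2, h3, -⟩ | ⟨-, h2, h3, -⟩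
    · left
      refine h2.trans ?_
      have := smul_le_smul_of_nonneg_left h3 (inv_pos.2 (div_pos hM0 hm0)).le
      rwa [smul_smul, show (M' / m')⁻¹ * M' = m' by field_simp] at this
    · right
      refine le_trans ?_ h3
      have := smul_le_smul_of_nonneg_left h2 (div_pos hM0 hm0).le
      rwa [smul_smul, show M' / m' * m' = M' by field_simp] at this
  have h1 := smul_le_smul_of_nonneg_left
    (kantorovich_smul_weightedGeomMean_inv_le ha hb hh hν hab) (mul_pos hM hm).le
  rw [smul_smul] at h1
  refine (add_le_add_right h1 _).trans ?_
  -- The bounds for `a` and `b` are averaged with weights `1 - ν` and `ν`.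
  have h2 := smul_le_smul_of_nonneg_left (add_smul_inv_le hm ha1 ha2) (sub_nonneg.2 hν.2)
  have h3 := smul_le_smul_of_nonneg_left (add_smul_inv_le hm hb1 hb2) hν.1
  convert add_le_add h2 h3 using 1
  · rw [weightedArithMean]; module
  · module

lemma smul_one_le_weightedArithMean {ν : ℝ} (hν : ν ∈ Set.Icc (0 : ℝ) 1) (ha : m • 1 ≤ a)
    (hb : m • 1 ≤ b) : m • 1 ≤ weightedArithMean ν a b := by
  have := add_le_add (smul_le_smul_of_nonneg_left ha (sub_nonneg.2 hν.2))
    (smul_le_smul_of_nonneg_left hb hν.1)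
  rwa [← add_smul, sub_add_cancel, one_smul] at this

lemma weightedArithMean_le_smul_one {ν : ℝ} (hν : ν ∈ Set.Icc (0 : ℝ) 1) (ha : a ≤ M • 1)
    (hb : b ≤ M • 1) : weightedArithMean ν a b ≤ M • 1 := by
  have := add_le_add (smul_le_smul_of_nonneg_left ha (sub_nonneg.2 hν.2))
    (smul_le_smul_of_nonneg_left hb hν.1)
  rwa [← add_smul, sub_add_cancel, one_smul] at this

end GeomMean

end Main

/-! ### The two inequalities for `Φ` -/

theorem mainTheorem3
    {H : Type*} [NormedAddCommGroup H] [InnerProductSpace ℂ H] [CompleteSpace H]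
    {K : Type*} [NormedAddCommGroup K] [InnerProductSpace ℂ K] [CompleteSpace K]
    (Φ : (H →L[ℂ] H) →ₚ[ℂ] (K →L[ℂ] K)) (hΦ : Φ 1 = 1)
    (m m' M' M : ℝ) (hm : 0 < m) (hm' : m' < M')
    (A B : H →L[ℂ] H)
    (hAB : (m • 1 ≤ B ∧ B ≤ m' • 1 ∧ M' • 1 ≤ A ∧ A ≤ M • 1) ∨
      (m • 1 ≤ A ∧ A ≤ m' • 1 ∧ M' • 1 ≤ B ∧ B ≤ M • 1))
    (p : ℝ) (hp : 4 ≤ p) (ν : ℝ) (hν : ν ∈ Set.Icc (0 : ℝ) 1)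
    (r h h' : ℝ) (hr : r = min ν (1 - ν)) (hh : h = M / m) (hh' : h' = M' / m') :
    (Φ (weightedArithMean ν A B)) ^ p ≤
        ((√(kantorovich (h ^ 2)) * kantorovich h /
          ((2 : ℝ) ^ (4 / p - 1) * kantorovich h' ^ r)) ^ p) •
          (Φ (weightedGeomMean ν A B)) ^ p ∧
      (Φ (weightedArithMean ν A B)) ^ p ≤
        ((√(kantorovich (h ^ 2)) * kantorovich h /
          ((2 : ℝ) ^ (4 / p - 1) * kantorovich h' ^ r)) ^ p) •
          (weightedGeomMean ν (Φ A) (Φ B)) ^ p := by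
  -- Over the zero algebra the hypotheses do not order the scalars, but `Φ 1 = 1` then makes the
  -- target trivial too.
  rcases subsingleton_or_nontrivial (H →L[ℂ] H) with hH | hH
  · have h10 : (1 : K →L[ℂ] K) = 0 := by
      rw [← hΦ, Subsingleton.elim (1 : H →L[ℂ] H) 0, map_zero]
    have : Subsingleton (K →L[ℂ] K) := subsingleton_of_zero_eq_one h10.symm
    exact ⟨(Subsingleton.elim _ _).le, (Subsingleton.elim _ _).le⟩
  have hs : IsSandwiched m m' M' M A B := hAB
  obtain ⟨hmm, hMM⟩ : m ≤ m' ∧ M' ≤ M := by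
    rcases hAB with ⟨h1, h2, h3, h4⟩ | ⟨h1, h2, h3, h4⟩ <;>
    exact ⟨le_of_smul_one_le_smul_one (h1.trans h2), le_of_smul_one_le_smul_one (h3.trans h4)⟩
  have hsΦ : IsSandwiched m m' M' M (Φ A) (Φ B) := by
    rcases hAB with ⟨h1, h2, h3, h4⟩ | ⟨h1, h2, h3, h4⟩
    · exact .inl ⟨Φ.map_smul_one_le hΦ h1, Φ.map_le_smul_one hΦ h2, Φ.map_smul_one_le hΦ h3,
        Φ.map_le_smul_one hΦ h4⟩
    · exact .inr ⟨Φ.map_smul_one_le hΦ h1, Φ.map_le_smul_one hΦ h2, Φ.map_smul_one_le hΦ h3,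
        Φ.map_le_smul_one hΦ h4⟩
  have hM : 0 < M := by linarith
  have hκ : 0 < kantorovich (M' / m') ^ min ν (1 - ν) :=
    Real.rpow_pos_of_pos (kantorovich_pos (div_pos (by linarith) (by linarith))) _
  have hmean : Φ (weightedArithMean ν A B) = weightedArithMean ν (Φ A) (Φ B) := by
    simp only [weightedArithMean, map_add, Φ.map_real_smul]
  obtain ⟨ha1, ha2, hb1, hb2⟩ := hs.bounds hmm hm' hMM
  obtain ⟨hc1, hc2, hd1, hd2⟩ := hsΦ.bounds hmm hm' hMM
  have hX1 := smul_one_le_weightedArithMean hν hc1 hd1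
  have hX2 := weightedArithMean_le_smul_one hν hc2 hd2
  have hG := isStrictlyPositive_weightedGeomMean (isStrictlyPositive_of_smul_one_le hm ha1)
    (isStrictlyPositive_of_smul_one_le hm hb1) ν
  subst hr hh hh'
  rw [hmean]
  constructor
  · refine rpow_le_kantorovich_smul_rpow hm hM hκ hp hX1 hX2 (hG.map_of_unital Φ hΦ) ?_
    have h1 := Φ.map_le_smul_one hΦ (hs.weightedArithMean_add_le hm hmm hm' hMM hν)
    rw [map_add, Φ.map_real_smul, hmean] at h1
    -- Choi's inequality replaces `Φ((A # B)⁻¹)` by the smaller `Φ(A # B)⁻¹`.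
    refine le_trans (add_le_add_right (smul_le_smul_of_nonneg_left
      (rpow_neg_one_map_le_map_rpow_neg_one Φ hΦ hG) ?_) _) h1
    exact (mul_pos (mul_pos hM hm) hκ).le
  · exact rpow_le_kantorovich_smul_rpow hm hM hκ hp hX1 hX2
      (isStrictlyPositive_weightedGeomMean (isStrictlyPositive_of_smul_one_le hm hc1)
        (isStrictlyPositive_of_smul_one_le hm hd1) ν)
      (hsΦ.weightedArithMean_add_le hm hmm hm' hMM hν)
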